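/- Let $d\ge 1$ and let $f:\mathbb R^d\to\mathbb R$ be twice differentiable and bounded below, with infimum $f^\star$. Call $f$ $\ell$-gradient Lipschitz if $\|\nabla f(x)-\nabla f(y)\|\le \ell\|x-y\|$ for all $x,y$, and $\rho$-Hessian Lipschitz if $\|\nabla^2 f(x)-\nabla^2 f(y)\|\le\rho\|x-y\|$ for all $x,y$ (Euclidean norm for vectors, spectral norm for matrices). A point $x$ is an $\epsilon$-second-order stationary point of a $\rho$-Hessian Lipschitz $f$ if $\|\nabla f(x)\|\le\epsilon$ and $\nabla^2 f(x)\succeq-\sqrt{\rho\epsilon}\,I$. Perturbed gradient descent (PGD) with step size $\eta>0$ and perturbation radius $r>0$, started at $x_0\in\mathbb R^d$, is the iteration $$x_{t+1}=x_t-\eta\,(\nabla f(x_t)+\xi_t),\qquad t=0,1,2,\dots,$$ where $\xi_0,\xi_1,\dots$ are independent with law $\mathcal N(0,(r^2/d)I)$. For nonnegative quantities $F,G$ depending on parameters $(d,\ell,\rho,\epsilon,\delta,\Delta)$, write $F=\tilde O(G)$ if there are absolute constants $C>0$ and $k\in\mathbb N$ with $F\le C\,\Lambda^k\,G$ for all integers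 $d\ge1$ and all reals $\ell,\rho,\epsilon,\delta>0$, $\Delta\ge0$, where $\Lambda=\log(2+d+\ell+\rho+1/\epsilon+1/\delta+\Delta)$; that is, $\tilde O$ hides an absolute constant and a factor polylogarithmic in $d,\ell,\rho,1/\epsilon,1/\delta,\Delta$. Write $F=\tilde\Theta(G)$ if $F=\tilde O(G)$ and $G=\tilde O(F)$. **Theorem 2.** There is a choice of $\eta>0$, $r>0$ and $T\in\mathbb N$ as functions of $(d,\ell,\rho,\epsilon,\delta,\Delta)$ only, with $$\eta=\tilde\Theta(1/\ell),\qquad r=\tilde\Theta(\epsilon),\qquad T=\tilde O\!\left(\frac{\ell\,\Delta}{\epsilon^2}\right),$$ such that the following holds for all integers $d\ge1$ and all reals $\ell,\rho,\epsilon,\delta>0$: for every $f:\mathbb R^d\to\mathbb R$ that is $\ell$-gradient Lipschitz, $\rho$-Hessian Lipschitz and bounded below, and for every $x_0\in\mathbb R^d$, if $\Delta=f(x_0)-f^\star$, then with probability at least $1-\delta$ at least one of the PGD iterates $x_0,x_1,\dots,x_T$ (run with these $\eta$ and $r$) is an $\epsilon$-second-order stationary point of $f$. In particular, the number of iterations depends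 on the dimension only polylogarithmically. -/

import Mathlib

open MeasureTheory ProbabilityTheory

noncomputable section

namespace PGD

/-- The ambient space `ℝ^d` with the `ℓ²` norm. -/
abbrev Vec (d : ℕ) : Type := EuclideanSpace ℝ (Fin d)

/-- The Hessian of `f` at `x`, as a linear operator on `ℝ^d`: the derivative of the gradient. -/
def hessian {d : ℕ} (f : Vec d → ℝ) (x : Vec d) : Vec d →L[ℝ] Vec d :=
  fderiv ℝ (gradient f) x

/-- A differentiable function is `ℓ`-gradient Lipschitz if its gradient is `ℓ`-Lipschitz. -/
def GradientLipschitz {d : ℕ} (ℓ : ℝ) (f : Vec d → ℝ) : Prop :=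
  Differentiable ℝ f ∧ ∀ x y, ‖gradient f x - gradient f y‖ ≤ ℓ * ‖x - y‖

/-- A twice-differentiable function is `ρ`-Hessian Lipschitz if its Hessian is `ρ`-Lipschitz in
the spectral (operator) norm. -/
def HessianLipschitz {d : ℕ} (ρ : ℝ) (f : Vec d → ℝ) : Prop :=
  Differentiable ℝ f ∧ Differentiable ℝ (gradient f) ∧
    ∀ x y, ‖hessian f x - hessian f y‖ ≤ ρ * ‖x - y‖

/-- `x` is an `ε`-second-order stationary point of the `ρ`-Hessian Lipschitz function `f`:
`‖∇f(x)‖ ≤ ε` and `∇²f(x) ⪰ -√(ρε) I`. -/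
def IsSOSP {d : ℕ} (ρ ε : ℝ) (f : Vec d → ℝ) (x : Vec d) : Prop :=
  ‖gradient f x‖ ≤ ε ∧
    ∀ v : Vec d, -Real.sqrt (ρ * ε) * ‖v‖ ^ 2 ≤ inner ℝ v (hessian f x v)

/-- The iterates of perturbed gradient descent started at `x₀` with step size `η`, driven by the
noise sequence `ξ`: `x_{t+1} = x_t - η (∇f(x_t) + ξ_t)`. -/
def iterate {d : ℕ} (f : Vec d → ℝ) (η : ℝ) (x₀ : Vec d) (ξ : ℕ → Vec d) : ℕ → Vec d
  | 0 => x₀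
  | t + 1 => iterate f η x₀ ξ t - η • (gradient f (iterate f η x₀ ξ t) + ξ t)

/-- The law `N(0, (r²/d) I)` of a single perturbation. -/
def noiseLaw (d : ℕ) (r : ℝ) : Measure (Vec d) :=
  multivariateGaussian 0 ((r ^ 2 / (d : ℝ)) • (1 : Matrix (Fin d) (Fin d) ℝ))

/-- The problem parameters: the dimension `d`, the Lipschitz constants `ℓ` and `ρ` of the gradient
and the Hessian, the accuracy `ε`, the failure probability `δ`, and the initial gap
`Δ = f(x₀) - f*`. -/
structure Params where
  d : ℕ
  ℓ : ℝ
  ρ : ℝ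
  ε : ℝ
  δ : ℝ
  Δ : ℝ
  d_pos : 0 < d
  ℓ_pos : 0 < ℓ
  ρ_pos : 0 < ρ
  ε_pos : 0 < ε
  δ_pos : 0 < δ
  Δ_nonneg : 0 ≤ Δ

/-- The logarithm `log (2 + d + ℓ + ρ + 1/ε + 1/δ + Δ)`; its powers dominate all products of powers
of the logarithms of the individual quantities `d, ℓ, ρ, 1/ε, 1/δ, Δ`. It is larger than `1`
because `d ≥ 1`. -/
def Params.logFactor (p : Params) : ℝ :=
  Real.log (2 + (p.d : ℝ) + p.ℓ + p.ρ + 1 / p.ε + 1 / p.δ + p.Δ)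

/-- `F = Õ(G)`: `F` is at most `G` up to an absolute constant and a factor that is polylogarithmic
in `d, ℓ, ρ, 1/ε, 1/δ, Δ`. -/
def SoftO (F G : Params → ℝ) : Prop :=
  ∃ (C : ℝ) (k : ℕ), ∀ p : Params, |F p| ≤ C * p.logFactor ^ k * |G p|

/-- `F = Θ̃(G)`: `F = Õ(G)` and `G = Õ(F)`. -/
def SoftTheta (F G : Params → ℝ) : Prop :=
  SoftO F G ∧ SoftO G F

end PGD

end

noncomputable section

namespace PGD

/-! Write `γ = √(ρε)`, `η = 1/(2ℓ)`, and let `R`, slightly larger than `r` but at most `ε/2`, be a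
bound that all relevant noises satisfy with high probability. As long as no second-order stationary
point is met, `f` decreases by at least `ηR²` per step on average. Where the gradient exceeds `ε`, a
single step achieves this. Elsewhere the iterate is a saddle of curvature below `-γ`; if the path
leaves the ball of radius `S` around it within `m` steps, Cauchy–Schwarz turns the distance
travelled into enough descent (`iterate_decrease_of_moved`). After `T` steps the total decrease
would exceed `Δ`, which is absurd (`exists_iterate_decrease`).

It remains to see that being stuck near a saddle is unlikely. Freeze every noise except the one at
the time `s` of the saddle. Two stuck trajectories whose noises at time `s` differ by `c • e`, with
`e` the most unstable direction, have a difference that evolves by a perturbed power iteration of `I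
- η∇²f` and so grows like `(1 + ηγ)^n`, while both stay in the ball. Hence `|c|` is tiny
(`abs_le_of_stuck`): the bad noises are thin along `e`, and a thin set has small Gaussian measure
(`noiseLaw_le_of_thin`). Only `√d` is lost, and it enters through a logarithm, because the growth is
exponential.

A union bound over noises and times finishes the proof. Since `1/ρ` is not allowed in the
logarithms, a saddle with small `γ` is controlled by the decrease `γ³/(64ρ²)` that its negative
curvature permits: if this exceeds `Δ`, no such saddle is reachable. -/

variable {d : ℕ} {f : Vec d → ℝ} {ℓ ρ : ℝ}

/-! ### Taylor estimates and one-step descent -/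

lemma HessianLipschitz.hasFDerivAt_gradient (hf : HessianLipschitz ρ f) (x : Vec d) :
    HasFDerivAt (gradient f) (hessian f x) x :=
  (hf.2.1 x).hasFDerivAt

lemma hasFDerivAt_inner_gradient (hf : Differentiable ℝ f) (x : Vec d) :
    HasFDerivAt f (innerSL ℝ (gradient f x)) x :=
  (hf x).hasGradientAt.hasFDerivAt

lemma HessianLipschitz.hessian_symm (hf : HessianLipschitz ρ f) (x u v : Vec d) :
    inner ℝ (hessian f x u) v = inner ℝ u (hessian f x v) := by
  have h := second_derivative_symmetric (𝕜 := ℝ) (f := f)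
    (f' := fun y => innerSL ℝ (gradient f y))
    (f'' := (innerSL ℝ).comp (hessian f x)) (x := x)
    (hasFDerivAt_inner_gradient hf.1)
    ((innerSL ℝ).hasFDerivAt.comp x (hf.hasFDerivAt_gradient x)) u v
  simpa [real_inner_comm] using h

lemma GradientLipschitz.norm_hessian_le (hf : GradientLipschitz ℓ f) (hℓ : 0 ≤ ℓ) (x : Vec d) :
    ‖hessian f x‖ ≤ ℓ :=
  norm_fderiv_le_of_lip' ℝ hℓ (Filter.Eventually.of_forall fun y => hf.2 y x)

/-- On a ball of radius `S` around `z`, the gradient is linear up to a relative error `ρ S`. -/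
lemma HessianLipschitz.norm_gradient_sub_sub_le (hf : HessianLipschitz ρ f) (hρ : 0 ≤ ρ)
    {S : ℝ} {x y z : Vec d} (hx : ‖x - z‖ ≤ S) (hy : ‖y - z‖ ≤ S) :
    ‖gradient f y - gradient f x - hessian f z (y - x)‖ ≤ ρ * S * ‖y - x‖ := by
  refine Convex.norm_image_sub_le_of_norm_hasFDerivWithin_le' (s := Metric.closedBall z S)
    (fun w _ => (hf.hasFDerivAt_gradient w).hasFDerivWithinAt) (fun w hw => ?_)
    (convex_closedBall z S) ?_ ?_
  · refine (hf.2.2 w z).trans (mul_le_mul_of_nonneg_left ?_ hρ)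
    simpa [dist_eq_norm] using hw
  · simpa [dist_eq_norm] using hx
  · simpa [dist_eq_norm] using hy

/-- Mean value inequality on the ball of radius `‖h‖`. The sharp constant `ℓ/2` is not needed: `ℓ`
matches the step size `1/(2ℓ)`. -/
lemma GradientLipschitz.le_quadratic (hf : GradientLipschitz ℓ f) (hℓ : 0 ≤ ℓ) (x h : Vec d) :
    f (x + h) ≤ f x + inner ℝ (gradient f x) h + ℓ * ‖h‖ ^ 2 := by
  have key := Convex.norm_image_sub_le_of_norm_hasFDerivWithin_le' (𝕜 := ℝ)
    (s := Metric.closedBall x ‖h‖) (f := f) (f' := fun y => innerSL ℝ (gradient f y))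
    (φ := innerSL ℝ (gradient f x)) (C := ℓ * ‖h‖) (x := x) (y := x + h)
    (fun w _ => (hasFDerivAt_inner_gradient hf.1 w).hasFDerivWithinAt) (fun w hw => ?_)
    (convex_closedBall x ‖h‖) (by simp) (by simp)
  · have := (le_abs_self _).trans key
    simp only [add_sub_cancel_left, innerSL_apply_apply] at this
    nlinarith
  · rw [← map_sub, innerSL_apply_norm]
    refine (hf.2 w x).trans (mul_le_mul_of_nonneg_left ?_ hℓ)
    simpa [dist_eq_norm] using hw

lemma HessianLipschitz.le_cubic (hf : HessianLipschitz ρ f) (hρ : 0 ≤ ρ) (x h : Vec d) :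
    f (x + h) ≤ f x + inner ℝ (gradient f x) h + inner ℝ h (hessian f x h) / 2
      + ρ * ‖h‖ ^ 3 := by
  -- Remove the quadratic Taylor term, so that the mean value inequality for what is left has a
  -- derivative error of second order. Symmetry of the Hessian identifies the derivative.
  have hder : ∀ w, HasFDerivAt (fun y => f y - inner ℝ (y - x) (hessian f x (y - x)) / 2)
      (innerSL ℝ (gradient f w - hessian f x (w - x))) w := by
    intro w
    have h1 : HasFDerivAt (fun y : Vec d => y - x) (ContinuousLinearMap.id ℝ (Vec d)) w :=
      (hasFDerivAt_id w).sub_const x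
    have h2 := (hessian f x).hasFDerivAt.comp w h1
    have h3 := (hasFDerivAt_inner_gradient hf.1 w).sub ((h1.inner ℝ h2).mul_const (1 / 2 : ℝ))
    refine (h3.congr_fderiv ?_).congr_of_eventuallyEq (Filter.Eventually.of_forall fun y => ?_)
    · ext v
      have := hf.hessian_symm x (w - x) v
      simp [fderivInnerCLM_apply, inner_sub_left, inner_sub_right] at this ⊢
      rw [real_inner_comm (hessian f x w) v, real_inner_comm (hessian f x x) v]
      linarith
    · simp [div_eq_mul_inv]
  have key := Convex.norm_image_sub_le_of_norm_hasFDerivWithin_le' (𝕜 := ℝ)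
    (s := Metric.closedBall x ‖h‖)
    (φ := innerSL ℝ (gradient f x)) (C := ρ * ‖h‖ * ‖h‖) (x := x) (y := x + h)
    (fun w _ => (hder w).hasFDerivWithinAt) (fun w hw => ?_)
    (convex_closedBall x ‖h‖) (by simp) (by simp)
  · have := (le_abs_self _).trans key
    simp only [add_sub_cancel_left, innerSL_apply_apply, sub_self, inner_zero_left] at this
    nlinarith
  · have hw' : ‖w - x‖ ≤ ‖h‖ := by simpa [dist_eq_norm] using hw
    rw [← map_sub, innerSL_apply_norm, sub_right_comm]
    refine (hf.norm_gradient_sub_sub_le hρ (S := ‖h‖) (by simp) hw').trans ?_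
    gcongr

/-- A direction of curvature below `-γ` allows a decrease of the function by `γ³ / (64 ρ²)`. -/
lemma HessianLipschitz.exists_le_of_neg_curvature (hf : HessianLipschitz ρ f) (hρ : 0 < ρ)
    {γ : ℝ} (hγ : 0 ≤ γ) {x v : Vec d} (hv : inner ℝ v (hessian f x v) < -γ * ‖v‖ ^ 2) :
    ∃ y, f y ≤ f x - γ ^ 3 / (64 * ρ ^ 2) := by
  have hv0 : v ≠ 0 := by rintro rfl; simp at hv
  obtain ⟨u, hu1, hu2, hu3⟩ : ∃ u : Vec d, ‖u‖ = 1 ∧ inner ℝ u (hessian f x u) ≤ -γ ∧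
      inner ℝ (gradient f x) u ≤ 0 := by
    have hn : 0 < ‖v‖ := norm_pos_iff.2 hv0
    have h1 : ‖‖v‖⁻¹ • v‖ = 1 := by
      rw [norm_smul, norm_inv, norm_norm, inv_mul_cancel₀ hn.ne']
    have h2 : inner ℝ (‖v‖⁻¹ • v) (hessian f x (‖v‖⁻¹ • v)) ≤ -γ := by
      rw [map_smul, real_inner_smul_left, real_inner_smul_right, ← mul_assoc, ← mul_inv,
        inv_mul_le_iff₀ (by positivity)]
      nlinarith
    rcases le_total (inner ℝ (gradient f x) (‖v‖⁻¹ • v)) 0 with h | h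
    · exact ⟨_, h1, h2, h⟩
    · exact ⟨-(‖v‖⁻¹ • v), by rwa [norm_neg], by simpa using h2, by simpa using h⟩
  -- The gradient term has a favourable sign, and at `s = γ/(4ρ)` the rest, `-γs²/2 + ρs³`, equals
  -- `-γ³/(64ρ²)`.
  refine ⟨x + (γ / (4 * ρ)) • u, ?_⟩
  have hs : 0 ≤ γ / (4 * ρ) := by positivity
  have h := hf.le_cubic hρ.le x ((γ / (4 * ρ)) • u)
  rw [norm_smul, hu1, Real.norm_of_nonneg hs, map_smul, real_inner_smul_right,
    real_inner_smul_left, real_inner_smul_right] at h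
  have e1 : γ / (4 * ρ) * inner ℝ (gradient f x) u ≤ 0 := mul_nonpos_of_nonneg_of_nonpos hs hu3
  have e2 : γ / (4 * ρ) * (γ / (4 * ρ) * inner ℝ u (hessian f x u)) ≤
      γ / (4 * ρ) * (γ / (4 * ρ) * -γ) := by gcongr
  have e3 : γ / (4 * ρ) * (γ / (4 * ρ) * -γ) / 2 + ρ * (γ / (4 * ρ) * 1) ^ 3 =
      - (γ ^ 3 / (64 * ρ ^ 2)) := by field_simp; ring
  linarith

/-- One gradient step of size `1 / (2ℓ)` with error `ξ`. -/
lemma GradientLipschitz.descent (hf : GradientLipschitz ℓ f) (hℓ : 0 < ℓ) {η : ℝ}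
    (hη : η = 1 / (2 * ℓ)) (x ξ : Vec d) :
    f (x - η • (gradient f x + ξ)) ≤
      f x - η / 2 * ‖gradient f x‖ ^ 2 + η / 2 * ‖ξ‖ ^ 2 := by
  have h := hf.le_quadratic hℓ.le x (-(η • (gradient f x + ξ)))
  rw [← sub_eq_add_neg, norm_neg, inner_neg_right, real_inner_smul_right, inner_add_right,
    real_inner_self_eq_norm_sq, norm_smul, mul_pow, Real.norm_eq_abs, sq_abs,
    norm_add_sq_real] at h
  have e : ℓ * η = 1 / 2 := by subst hη; field_simp
  -- Since `ℓη² = η/2`, the cross terms in gradient and noise cancel exactly.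
  have e' : ∀ q : ℝ, ℓ * (η ^ 2 * q) = η / 2 * q := fun q => by
    linear_combination η * q * e
  rw [e'] at h
  linarith

/-! ### Perturbed power iteration -/

/-- The norm of a positive symmetric operator on a nontrivial finite-dimensional space is an
eigenvalue. -/
lemma exists_eigenvector_norm {E : Type*} [NormedAddCommGroup E] [InnerProductSpace ℝ E]
    [FiniteDimensional ℝ E] [Nontrivial E] (M : E →L[ℝ] E)
    (hM : (M : E →ₗ[ℝ] E).IsSymmetric) (hpos : ∀ v, 0 ≤ inner ℝ (M v) v) :
    ∃ e : E, ‖e‖ = 1 ∧ M e = ‖M‖ • e := by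
  have hnn : ∀ x, 0 ≤ M.rayleighQuotient x := fun x => div_nonneg (hpos x) (sq_nonneg _)
  have hle : ∀ x, M.rayleighQuotient x ≤ ‖M‖ := fun x =>
    (le_abs_self _).trans (M.rayleighQuotient_le_norm x)
  have h1 : ‖M‖ = ⨆ x : {x : E // x ≠ 0}, M.rayleighQuotient x := by
    have hbdd : BddAbove (Set.range fun x : {x : E // x ≠ 0} => M.rayleighQuotient x) :=
      ⟨‖M‖, by rintro _ ⟨x, rfl⟩; exact hle x⟩
    have : Nonempty {x : E // x ≠ 0} := let ⟨x, hx⟩ := exists_ne (0 : E); ⟨⟨x, hx⟩⟩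
    refine le_antisymm ?_ (ciSup_le fun x => hle x)
    rw [M.norm_eq_iSup_rayleighQuotient hM]
    refine ciSup_le fun x => ?_
    rw [abs_of_nonneg (hnn x)]
    by_cases hx : x = 0
    · rw [hx, M.rayleighQuotient_apply_zero]
      exact Real.iSup_nonneg fun x => hnn x
    · exact le_ciSup hbdd ⟨x, hx⟩
  have h2 := hM.hasEigenvalue_iSup_of_finiteDimensional
  obtain ⟨v, hv⟩ := h2.exists_hasEigenvector
  have hn : ‖v‖ ≠ 0 := norm_ne_zero_iff.2 hv.2
  refine ⟨‖v‖⁻¹ • v, ?_, ?_⟩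
  · rw [norm_smul, norm_inv, norm_norm, inv_mul_cancel₀ hn]
  · have h3 : M v = ‖M‖ • v := by
      rw [h1]; exact hv.apply_eq_smul
    rw [map_smul, h3, smul_comm]

/-- A perturbed power iteration started at an eigenvector for the norm stays close to the exact
one. -/
lemma norm_sub_pow_smul_le {E : Type*} [NormedAddCommGroup E] [NormedSpace ℝ E]
    {M : E →L[ℝ] E} {β : ℝ} (hβ : 0 ≤ β) {v : ℕ → E} {n : ℕ}
    (h0 : M (v 0) = ‖M‖ • v 0) (hv : ∀ t < n, ‖v (t + 1) - M (v t)‖ ≤ β * ‖v t‖) :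
    ∀ t ≤ n, ‖v t - ‖M‖ ^ t • v 0‖ ≤ ((‖M‖ + β) ^ t - ‖M‖ ^ t) * ‖v 0‖ := by
  -- With `α = ‖M‖`, the error `E t` satisfies `E (t+1) ≤ (α + β) E t + β α^t ‖v 0‖`, whose solution
  -- from `0` is `((α + β)^t - α^t) ‖v 0‖`.
  intro t
  induction t with
  | zero => simp
  | succ t ih =>
    intro ht
    have ih := ih (by lia)
    have hα := norm_nonneg M
    have e : v (t + 1) - ‖M‖ ^ (t + 1) • v 0 =
        (v (t + 1) - M (v t)) + M (v t - ‖M‖ ^ t • v 0) := by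
      rw [map_sub, map_smul, h0, smul_smul, ← pow_succ]; abel
    have h1 : ‖v t‖ ≤ ‖M‖ ^ t * ‖v 0‖ + ‖v t - ‖M‖ ^ t • v 0‖ := by
      have := norm_add_le (‖M‖ ^ t • v 0) (v t - ‖M‖ ^ t • v 0)
      rwa [add_sub_cancel, norm_smul, norm_pow, norm_norm] at this
    calc ‖v (t + 1) - ‖M‖ ^ (t + 1) • v 0‖
        ≤ ‖v (t + 1) - M (v t)‖ + ‖M (v t - ‖M‖ ^ t • v 0)‖ := by rw [e]; exact norm_add_le _ _
      _ ≤ β * ‖v t‖ + ‖M‖ * ‖v t - ‖M‖ ^ t • v 0‖ :=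
          add_le_add (hv t (by lia)) (M.le_opNorm _)
      _ ≤ β * (‖M‖ ^ t * ‖v 0‖ + ‖v t - ‖M‖ ^ t • v 0‖) + ‖M‖ * ‖v t - ‖M‖ ^ t • v 0‖ := by
          gcongr
      _ = β * ‖M‖ ^ t * ‖v 0‖ + (‖M‖ + β) * ‖v t - ‖M‖ ^ t • v 0‖ := by ring
      _ ≤ β * ‖M‖ ^ t * ‖v 0‖ + (‖M‖ + β) * (((‖M‖ + β) ^ t - ‖M‖ ^ t) * ‖v 0‖) := by gcongr
      _ = ((‖M‖ + β) ^ (t + 1) - ‖M‖ ^ (t + 1)) * ‖v 0‖ := by ring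

/-- As `‖M‖ ≥ 1`, `(‖M‖ + β)^n ≤ ‖M‖^n (1 + β)^n`, and `βn ≤ 1/3` bounds the last factor by `3/2`;
the error is then at most half of the exact growth. -/
lemma half_pow_mul_norm_le {E : Type*} [NormedAddCommGroup E] [NormedSpace ℝ E]
    {M : E →L[ℝ] E} {β : ℝ} (hβ : 0 ≤ β) {v : ℕ → E} {n : ℕ} (hM : 1 ≤ ‖M‖)
    (hβn : β * n ≤ 1 / 3)
    (h0 : M (v 0) = ‖M‖ • v 0) (hv : ∀ t < n, ‖v (t + 1) - M (v t)‖ ≤ β * ‖v t‖) :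
    ‖M‖ ^ n * ‖v 0‖ / 2 ≤ ‖v n‖ := by
  have h1 := norm_sub_pow_smul_le hβ h0 hv n le_rfl
  have hexp : (1 + β) ^ n ≤ 3 / 2 := by
    calc (1 + β) ^ n ≤ Real.exp β ^ n := by
          gcongr; rw [add_comm]; exact Real.add_one_le_exp β
      _ = Real.exp (β * n) := by rw [← Real.exp_nat_mul, mul_comm]
      _ ≤ Real.exp (1 / 3) := Real.exp_le_exp.2 hβn
      _ ≤ 3 / 2 := by
          have h := Real.exp_bound_div_one_sub_of_interval (x := 1 / 3) (by norm_num) (by norm_num)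
          norm_num at h ⊢
          exact h
  have h2 : (‖M‖ + β) ^ n ≤ ‖M‖ ^ n * (3 / 2) := by
    calc (‖M‖ + β) ^ n ≤ (‖M‖ * (1 + β)) ^ n := by gcongr; nlinarith
      _ = ‖M‖ ^ n * (1 + β) ^ n := mul_pow _ _ _
      _ ≤ _ := by gcongr
  have h3 : ‖M‖ ^ n * ‖v 0‖ ≤ ‖v n‖ + ‖v n - ‖M‖ ^ n • v 0‖ := by
    have := norm_sub_le (v n) (v n - ‖M‖ ^ n • v 0)
    rwa [sub_sub_cancel, norm_smul, norm_pow, norm_norm] at this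
  have h4 : ((‖M‖ + β) ^ n - ‖M‖ ^ n) * ‖v 0‖ ≤ (‖M‖ ^ n * (1 / 2)) * ‖v 0‖ := by
    gcongr; linarith
  linarith

/-! ### Saddles and the coupling of stuck trajectories -/

/-- The curvature condition of a second-order stationary point fails with threshold `γ`. -/
def IsSaddle (γ : ℝ) (f : Vec d → ℝ) (x : Vec d) : Prop :=
  ¬ ∀ v : Vec d, -γ * ‖v‖ ^ 2 ≤ inner ℝ v (hessian f x v)

/-- The gradient step `I - η ∇²f(x)` at a saddle has an eigenvector for its norm, which is at least
`1 + ηγ`. -/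
lemma exists_unstable_direction (hf : GradientLipschitz ℓ f) (hf' : HessianLipschitz ρ f)
    (hℓ : 0 < ℓ) {η γ : ℝ} (hη : η = 1 / (2 * ℓ)) {z : Vec d} (hz : IsSaddle γ f z) :
    ∃ e : Vec d, ‖e‖ = 1 ∧
      (ContinuousLinearMap.id ℝ (Vec d) - η • hessian f z) e =
        ‖ContinuousLinearMap.id ℝ (Vec d) - η • hessian f z‖ • e ∧
      1 + η * γ ≤ ‖ContinuousLinearMap.id ℝ (Vec d) - η • hessian f z‖ := by
  set M := ContinuousLinearMap.id ℝ (Vec d) - η • hessian f z with hM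
  have hη0 : 0 < η := by subst hη; positivity
  have hηℓ : η * ℓ = 1 / 2 := by subst hη; field_simp
  have hMv : ∀ v, inner ℝ (M v) v = ‖v‖ ^ 2 - η * inner ℝ v (hessian f z v) := by
    intro v
    simp only [hM, sub_apply, ContinuousLinearMap.id_apply,
      smul_apply, inner_sub_left, real_inner_smul_left,
      real_inner_self_eq_norm_sq]
    rw [real_inner_comm]
  obtain ⟨v, hv⟩ : ∃ v : Vec d, inner ℝ v (hessian f z v) < -γ * ‖v‖ ^ 2 := by
    simpa [IsSaddle] using hz
  have hv0 : v ≠ 0 := by rintro rfl; simp at hv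
  have : Nontrivial (Vec d) := nontrivial_of_ne v 0 hv0
  obtain ⟨e, he1, he2⟩ := exists_eigenvector_norm M (fun u w => by
      have := hf'.hessian_symm z u w
      simp [hM, inner_sub_left, inner_sub_right, real_inner_smul_left, real_inner_smul_right,
        this]) (fun u => by
      rw [hMv]
      have h1 : inner ℝ u (hessian f z u) ≤ ℓ * ‖u‖ ^ 2 := by
        refine (real_inner_le_norm _ _).trans ?_
        have := (hessian f z).le_of_opNorm_le (hf.norm_hessian_le hℓ.le z) u
        nlinarith [norm_nonneg u]
      nlinarith [sq_nonneg ‖u‖])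
  refine ⟨e, he1, he2, ?_⟩
  have h1 : inner ℝ (M v) v ≤ ‖M‖ * ‖v‖ ^ 2 := by
    refine (real_inner_le_norm _ _).trans ?_
    have := M.le_opNorm v
    nlinarith [norm_nonneg v]
  rw [hMv] at h1
  have hn : 0 < ‖v‖ ^ 2 := by positivity
  by_contra! hlt
  nlinarith

lemma iterate_succ {η : ℝ} {x₀ : Vec d} {ξ : ℕ → Vec d} {t : ℕ} :
    iterate f η x₀ ξ (t + 1) =
      iterate f η x₀ ξ t - η • (gradient f (iterate f η x₀ ξ t) + ξ t) :=
  rfl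

lemma iterate_congr {η : ℝ} {x₀ : Vec d} {ξ ξ' : ℕ → Vec d} :
    ∀ {t : ℕ}, (∀ j < t, ξ j = ξ' j) → iterate f η x₀ ξ t = iterate f η x₀ ξ' t
  | 0, _ => rfl
  | t + 1, h => by
    simp only [iterate]
    rw [iterate_congr (t := t) fun j hj => h j (by lia), h t (by lia)]

/-- At time `s` the iterate is a saddle, and the next `m` iterates stay within distance `S`. -/
def Stuck (f : Vec d → ℝ) (η γ S : ℝ) (m : ℕ) (x₀ : Vec d) (s : ℕ) (ξ : ℕ → Vec d) : Prop :=
  IsSaddle γ f (iterate f η x₀ ξ s) ∧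
    ∀ j ≤ m, ‖iterate f η x₀ ξ (s + j) - iterate f η x₀ ξ s‖ ≤ S

/-- Two trajectories stuck at the same saddle, whose noises differ only at time `s` and in the
unstable direction `e`, have nearly equal noise at time `s`. -/
lemma abs_le_of_stuck (hf : GradientLipschitz ℓ f) (hf' : HessianLipschitz ρ f)
    (hℓ : 0 < ℓ) (hρ : 0 < ρ) {η γ S w : ℝ} (hη : η = 1 / (2 * ℓ)) (hγ : 0 ≤ γ) (hS : 0 ≤ S)
    {n : ℕ} (hβ : η * ρ * S * n ≤ 1 / 3) (hw : 4 * S ≤ w * (η * (1 + η * γ) ^ n))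
    (x₀ : Vec d) (s : ℕ) (b : ℕ → Vec d) :
    ∃ e : Vec d, (d ≠ 0 → ‖e‖ = 1) ∧ ∀ (y : Vec d) (c : ℝ),
      Stuck f η γ S (n + 1) x₀ s (Function.update b s y) →
      Stuck f η γ S (n + 1) x₀ s (Function.update b s (y + c • e)) → |c| ≤ w := by
  have hη0 : 0 < η := by subst hη; positivity
  -- The position at time `s` ignores the noise at time `s`, so the saddle and its direction `e`
  -- depend only on the frozen noises.
  have hbase : ∀ y, iterate f η x₀ (Function.update b s y) s = iterate f η x₀ b s := fun y =>
    iterate_congr fun j hj => Function.update_of_ne hj.ne _ _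
  set z := iterate f η x₀ b s with hzdef
  by_cases hz : IsSaddle γ f z
  swap
  · obtain ⟨e, he⟩ : ∃ e : Vec d, d ≠ 0 → ‖e‖ = 1 := by
      by_cases hd : d = 0
      · exact ⟨0, fun h => (h hd).elim⟩
      · exact ⟨EuclideanSpace.single ⟨0, by lia⟩ 1, fun _ => by simp⟩
    refine ⟨e, he, fun y c h _ => ?_⟩
    have h1 := h.1
    rw [hbase] at h1
    exact (hz h1).elim
  obtain ⟨e, he1, he2, he3⟩ := exists_unstable_direction hf hf' hℓ hη hz
  set M := ContinuousLinearMap.id ℝ (Vec d) - η • hessian f z with hM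
  refine ⟨e, fun _ => he1, fun y c h h' => ?_⟩
  set ξ := Function.update b s y with hξ
  set ξ' := Function.update b s (y + c • e) with hξ'
  have hs : ∀ j ≤ n, ‖iterate f η x₀ ξ (s + 1 + j) - z‖ ≤ S := fun j hj => by
    have := h.2 (1 + j) (by lia)
    rwa [hbase, ← add_assoc] at this
  have hs' : ∀ j ≤ n, ‖iterate f η x₀ ξ' (s + 1 + j) - z‖ ≤ S := fun j hj => by
    have := h'.2 (1 + j) (by lia)
    rwa [hbase, ← add_assoc] at this
  -- The trajectories first differ at time `s + 1`, by `-ηc • e`; hence `n + 1` stuck steps yield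
  -- `n` steps of growth. Later noises agree and cancel.
  let v : ℕ → Vec d := fun j => iterate f η x₀ ξ' (s + 1 + j) - iterate f η x₀ ξ (s + 1 + j)
  have hv0 : v 0 = -(η * c) • e := by
    simp only [v, add_zero]
    rw [iterate_succ, iterate_succ, hbase, hbase, hξ, hξ', Function.update_self, Function.update_self]
    module
  have hvs : ∀ t < n, ‖v (t + 1) - M (v t)‖ ≤ η * ρ * S * ‖v t‖ := by
    intro t ht
    have hne : s + 1 + t ≠ s := by lia
    have e1 : v (t + 1) - M (v t) = -(η • (gradient f (iterate f η x₀ ξ' (s + 1 + t)) -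
        gradient f (iterate f η x₀ ξ (s + 1 + t)) - hessian f z (v t))) := by
      simp only [v, hM, ← add_assoc, iterate_succ, sub_apply,
        ContinuousLinearMap.id_apply, smul_apply]
      rw [hξ, hξ', Function.update_of_ne hne, Function.update_of_ne hne]
      module
    rw [e1, norm_neg, norm_smul, Real.norm_of_nonneg hη0.le, mul_assoc, mul_assoc]
    have := hf'.norm_gradient_sub_sub_le hρ.le (hs t ht.le) (hs' t ht.le)
    rw [← mul_assoc ρ]
    exact mul_le_mul_of_nonneg_left this hη0.le
  have h1M : 1 ≤ ‖M‖ := le_trans (by nlinarith [mul_nonneg hη0.le hγ]) he3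
  have key := half_pow_mul_norm_le (M := M) (β := η * ρ * S) (v := v) (by positivity) h1M hβ
    (by rw [hv0, map_smul, he2, smul_comm]) hvs
  have hvn : ‖v n‖ ≤ 2 * S := by
    have := norm_sub_le (iterate f η x₀ ξ' (s + 1 + n) - z) (iterate f η x₀ ξ (s + 1 + n) - z)
    rw [sub_sub_sub_cancel_right] at this
    linarith [hs n le_rfl, hs' n le_rfl]
  rw [hv0, norm_smul, he1, mul_one, norm_neg, Real.norm_eq_abs, abs_mul, abs_of_pos hη0] at key
  have hpow : (1 + η * γ) ^ n ≤ ‖M‖ ^ n := by gcongr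
  have hq : 0 < η * (1 + η * γ) ^ n := by positivity
  have : |c| * (η * (1 + η * γ) ^ n) ≤ w * (η * (1 + η * γ) ^ n) := by
    calc |c| * (η * (1 + η * γ) ^ n) = (1 + η * γ) ^ n * (η * |c|) := by ring
      _ ≤ ‖M‖ ^ n * (η * |c|) := by gcongr
      _ ≤ _ := by linarith
  exact le_of_mul_le_mul_right this hq

/-! ### Gaussian noise: thin sets and tails -/

lemma posSemidef_noise (d : ℕ) (r : ℝ) :
    ((r ^ 2 / (d : ℝ)) • (1 : Matrix (Fin d) (Fin d) ℝ)).PosSemidef :=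
  Matrix.PosSemidef.one.smul (by positivity)

instance (d : ℕ) (r : ℝ) : IsProbabilityMeasure (noiseLaw d r) := by
  unfold noiseLaw; infer_instance

lemma charFun_noiseLaw (r : ℝ) (t : Vec d) :
    charFun (noiseLaw d r) t = Complex.exp (-(r ^ 2 / d * ‖t‖ ^ 2 / 2 : ℝ)) := by
  rw [noiseLaw, charFun_multivariateGaussian (posSemidef_noise d r)]
  congr 1
  have h : t.ofLp ⬝ᵥ t.ofLp = ‖t‖ ^ 2 := by
    rw [EuclideanSpace.real_norm_sq_eq]; simp [dotProduct, sq]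
  simp [Matrix.smul_mulVec, h]

/-- The noise is the sum of a vector and an independent Gaussian multiple of a given unit
vector. -/
lemma noiseLaw_eq_map_prod {r : ℝ} {e : Vec d} (he : ‖e‖ = 1) :
    noiseLaw d r = ((noiseLaw d r).prod (gaussianReal 0 (r ^ 2 / d).toNNReal)).map
      (fun p => (p.1 - inner ℝ e p.1 • e) + p.2 • e) := by
  have hm : Measurable fun p : Vec d × ℝ => (p.1 - inner ℝ e p.1 • e) + p.2 • e := by fun_prop
  have := Measure.isProbabilityMeasure_map (μ := (noiseLaw d r).prod
    (gaussianReal 0 (r ^ 2 / d).toNNReal)) hm.aemeasurable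
  refine Measure.ext_of_charFun (funext fun t => ?_)
  rw [charFun_apply (μ := Measure.map _ _), integral_map hm.aemeasurable (by fun_prop)]
  have h1 : ∀ p : Vec d × ℝ, Complex.exp (inner ℝ ((p.1 - inner ℝ e p.1 • e) + p.2 • e) t *
      Complex.I) = Complex.exp (inner ℝ p.1 (t - inner ℝ e t • e) * Complex.I) *
        Complex.exp (inner ℝ p.2 (inner ℝ e t) * Complex.I) := by
    intro p
    rw [← Complex.exp_add, ← add_mul, ← Complex.ofReal_add]
    congr 3
    simp only [inner_add_left, inner_sub_left, inner_sub_right, real_inner_smul_left,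
      real_inner_smul_right, real_inner_comm e p.1]
    simp
    ring
  simp_rw [h1]
  rw [integral_prod_mul (fun x : Vec d => Complex.exp (inner ℝ x (t - inner ℝ e t • e) *
    Complex.I)) (fun g : ℝ => Complex.exp (inner ℝ g (inner ℝ e t) * Complex.I)),
    ← charFun_apply, ← charFun_apply, charFun_noiseLaw, charFun_noiseLaw, charFun_gaussianReal,
    ← Complex.exp_add]
  congr 1
  have h2 : ‖t - inner ℝ e t • e‖ ^ 2 = ‖t‖ ^ 2 - inner ℝ e t ^ 2 := by
    rw [norm_sub_sq_real, norm_smul, he, real_inner_smul_right, real_inner_comm]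
    simp; ring
  rw [h2, Real.coe_toNNReal _ (by positivity)]
  push_cast
  ring

lemma gaussianReal_Icc_le {v : NNReal} (hv : v ≠ 0) (a w : ℝ) :
    gaussianReal 0 v (Set.Icc (a - w) (a + w)) ≤ ENNReal.ofReal (2 * w / √v) := by
  rw [gaussianReal_apply _ hv]
  have hv' : 0 < (v : ℝ) := by positivity
  have hpdf : ∀ x, gaussianPDF 0 v x ≤ ENNReal.ofReal (1 / √v) := by
    intro x
    refine ENNReal.ofReal_le_ofReal ?_
    rw [gaussianPDFReal]
    have h1 : Real.exp (-(x - 0) ^ 2 / (2 * v)) ≤ 1 :=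
      Real.exp_le_one_iff.2 (div_nonpos_of_nonpos_of_nonneg (by nlinarith [sq_nonneg (x - 0)])
        (by positivity))
    have h2 : (√(2 * Real.pi * v))⁻¹ ≤ 1 / √v := by
      rw [one_div]
      gcongr
      nlinarith [Real.pi_gt_three]
    calc _ ≤ (√(2 * Real.pi * v))⁻¹ * 1 := by gcongr
      _ ≤ _ := by simpa using h2
  calc ∫⁻ x in Set.Icc (a - w) (a + w), gaussianPDF 0 v x
      ≤ ∫⁻ x in Set.Icc (a - w) (a + w), ENNReal.ofReal (1 / √v) :=
        lintegral_mono fun x => hpdf x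
    _ = ENNReal.ofReal (2 * w / √v) := by
        rw [setLIntegral_const, Real.volume_Icc, ← ENNReal.ofReal_mul (by positivity)]
        congr 1; ring

/-- A measurable set whose intersection with every line in direction `e` has diameter at most `w`
has small noise measure. -/
lemma noiseLaw_le_of_thin {r w : ℝ} (hd : 0 < d) (hr : 0 < r) {e : Vec d}
    (he : ‖e‖ = 1) {B : Set (Vec d)} (hB : MeasurableSet B)
    (hthin : ∀ (y : Vec d) (c : ℝ), y ∈ B → y + c • e ∈ B → |c| ≤ w) :
    noiseLaw d r B ≤ ENNReal.ofReal (2 * w * √d / r) := by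
  have hm : Measurable fun p : Vec d × ℝ => (p.1 - inner ℝ e p.1 • e) + p.2 • e := by fun_prop
  have hd' : (0 : ℝ) < d := by exact_mod_cast hd
  have hv : (r ^ 2 / d).toNNReal ≠ 0 := by
    rw [Ne, Real.toNNReal_eq_zero, not_le]; positivity
  have hval : 2 * w / √((r ^ 2 / d).toNNReal : ℝ) = 2 * w * √d / r := by
    rw [Real.coe_toNNReal _ (by positivity), Real.sqrt_div (by positivity), Real.sqrt_sq hr.le]
    field_simp
  rw [noiseLaw_eq_map_prod he, Measure.map_apply hm hB, Measure.prod_apply (hm hB)]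
  calc ∫⁻ x, gaussianReal 0 (r ^ 2 / d).toNNReal (Prod.mk x ⁻¹' _) ∂noiseLaw d r
      ≤ ∫⁻ x, ENNReal.ofReal (2 * w * √d / r) ∂noiseLaw d r := by
        refine lintegral_mono fun x => ?_
        -- A nonempty fibre lies within `w` of any one of its points, so one-dimensional
        -- anti-concentration applies.
        rcases Set.eq_empty_or_nonempty (Prod.mk x ⁻¹'
          ((fun p : Vec d × ℝ => (p.1 - inner ℝ e p.1 • e) + p.2 • e) ⁻¹' B)) with h | ⟨a, ha⟩
        · simp [h]
        · rw [← hval]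
          refine (measure_mono fun g hg => ?_).trans (gaussianReal_Icc_le hv a w)
          have hg' : (x - inner ℝ e x • e + a • e) + (g - a) • e ∈ B := by
            have h : (x - inner ℝ e x • e) + g • e ∈ B := hg
            rwa [show (x - inner ℝ e x • e + a • e) + (g - a) • e =
              (x - inner ℝ e x • e) + g • e by module]
          have := abs_le.1 (hthin _ _ ha hg')
          exact ⟨by linarith, by linarith⟩
    _ = _ := by simp

lemma gaussianReal_abs_gt_le (v : NNReal) {a : ℝ} (ha : 0 ≤ a) :
    (gaussianReal 0 v).real {x | a < |x|} ≤ 2 * Real.exp (-a ^ 2 / (2 * v)) := by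
  have hsub : HasSubgaussianMGF id v (gaussianReal 0 v) :=
    ⟨fun t => by simpa using integrable_exp_mul_gaussianReal t, fun t => by
      rw [mgf_id_gaussianReal]; simp⟩
  have h1 := hsub.measure_ge_le ha
  have h2 := hsub.neg.measure_ge_le ha
  have hsubset : {x : ℝ | a < |x|} ⊆ {x | a ≤ id x} ∪ {x | a ≤ (-id) x} := by
    intro x hx
    have hx' : a < |x| := hx
    rcases lt_abs.1 hx' with h | h
    · exact Or.inl h.le
    · exact Or.inr h.le
  calc _ ≤ (gaussianReal 0 v).real ({x | a ≤ id x} ∪ {x | a ≤ (-id) x}) :=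
        measureReal_mono hsubset
    _ ≤ _ := (measureReal_union_le _ _).trans (by linarith)

lemma noiseLaw_norm_gt_le {r a : ℝ} (hd : 0 < d) (hr : 0 < r) (ha : 0 ≤ a) :
    (noiseLaw d r).real {x | r * a < ‖x‖} ≤ 2 * d * Real.exp (-a ^ 2 / 2) := by
  have hd' : (0 : ℝ) < d := by exact_mod_cast hd
  -- If every coordinate is at most `ra/√d` in absolute value, the norm is at most `ra`; the price
  -- is a union bound over coordinates.
  have hcoord : ∀ i : Fin d, (noiseLaw d r).real {x | r * a / √d < |x i|} ≤
      2 * Real.exp (-a ^ 2 / 2) := by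
    intro i
    have hmp := measurePreserving_eval_multivariateGaussian (μ := 0) (posSemidef_noise d r)
      (i := i)
    have h := gaussianReal_abs_gt_le (r ^ 2 / d).toNNReal (a := r * a / √d) (by positivity)
    have hms : MeasurableSet {x : ℝ | r * a / √d < |x|} :=
      measurableSet_lt measurable_const measurable_norm
    have heq := hmp.measureReal_preimage hms.nullMeasurableSet
    have h' : -(r * a / √d) ^ 2 / (2 * ((r ^ 2 / d).toNNReal : ℝ)) = -a ^ 2 / 2 := by
      rw [Real.coe_toNNReal _ (by positivity), div_pow, Real.sq_sqrt hd'.le]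
      field_simp
    rw [h'] at h
    simp at heq
    refine le_trans (le_of_eq ?_) h
    exact heq
  have hsub : {x : Vec d | r * a < ‖x‖} ⊆ ⋃ i : Fin d, {x | r * a / √d < |x i|} := by
    intro x hx
    by_contra hcon
    simp only [Set.mem_iUnion, Set.mem_ofPred_eq, not_exists, not_lt] at hcon hx
    have h1 : ‖x‖ ^ 2 ≤ (r * a) ^ 2 := by
      rw [EuclideanSpace.real_norm_sq_eq]
      calc ∑ i, x i ^ 2 ≤ ∑ i : Fin d, (r * a / √d) ^ 2 :=
            Finset.sum_le_sum fun i _ => sq_le_sq' (abs_le.1 (hcon i)).1 (abs_le.1 (hcon i)).2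
        _ = (r * a) ^ 2 := by
            rw [Finset.sum_const, div_pow, Real.sq_sqrt hd'.le]
            simp; field_simp
    exact absurd (abs_le_of_sq_le_sq h1 (by positivity)) (by
      rw [abs_of_nonneg (norm_nonneg x)]; exact not_le.2 hx)
  calc _ ≤ (noiseLaw d r).real (⋃ i : Fin d, {x | r * a / √d < |x i|}) := measureReal_mono hsub
    _ ≤ ∑ i : Fin d, (noiseLaw d r).real {x | r * a / √d < |x i|} := measureReal_iUnion_fintype_le _
    _ ≤ ∑ i : Fin d, 2 * Real.exp (-a ^ 2 / 2) := Finset.sum_le_sum fun i _ => hcoord i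
    _ = _ := by simp; ring

/-! ### Freezing all noises but one, and measurability -/

/-- Fubini for independent variables: a bound on all sections bounds the probability. -/
lemma measure_le_of_indepFun_of_section {Ω α β : Type*} [MeasurableSpace Ω] [MeasurableSpace α]
    [MeasurableSpace β] {P : Measure Ω} [IsProbabilityMeasure P] {X : Ω → α} {Y : Ω → β}
    (hX : AEMeasurable X P) (hY : AEMeasurable Y P) (hind : IndepFun X Y P) {A : Set (α × β)}
    (hA : MeasurableSet A) {q : ENNReal} (hq : ∀ y, P.map X {x | (x, y) ∈ A} ≤ q) :
    P {ω | (X ω, Y ω) ∈ A} ≤ q := by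
  have := Measure.isProbabilityMeasure_map hX
  have := Measure.isProbabilityMeasure_map hY
  have h1 : P {ω | (X ω, Y ω) ∈ A} = (P.map fun ω => (X ω, Y ω)) A :=
    (Measure.map_apply_of_aemeasurable (hX.prodMk hY) hA).symm
  rw [h1, (indepFun_iff_map_prod_eq_prod_map_map hX hY).1 hind, Measure.prod_apply_symm hA]
  calc ∫⁻ y, P.map X ((fun x => (x, y)) ⁻¹' A) ∂(P.map Y) ≤ ∫⁻ _, q ∂(P.map Y) :=
        lintegral_mono fun y => hq y
    _ = q := by simp

/-- Extension by zero of the first `n` noise vectors, except for the one at time `s`. -/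
def extendNoise (s n : ℕ) (y : ((Finset.range n).erase s : Finset ℕ) → Vec d) (j : ℕ) : Vec d :=
  if h : j ∈ (Finset.range n).erase s then y ⟨j, h⟩ else 0

lemma measurable_extendNoise (s n : ℕ) : Measurable (extendNoise (d := d) s n) := by
  refine measurable_pi_lambda _ fun j => ?_
  unfold extendNoise
  split_ifs with h
  · exact measurable_pi_apply _
  · exact measurable_const

/-- The event sees only the first `n` noises, so those other than the one at time `s` form a finite
family independent of it; setting the remaining noises to zero does not change the event. -/
lemma measure_le_of_iIndepFun_of_update {Ω : Type*} [MeasurableSpace Ω] {P : Measure Ω}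
    [IsProbabilityMeasure P] {ξ : ℕ → Ω → Vec d} (hξ : ∀ t, AEMeasurable (ξ t) P)
    (hind : iIndepFun ξ P) {A : Set (ℕ → Vec d)} (hA : MeasurableSet A) {s n : ℕ}
    (hdep : ∀ x y : ℕ → Vec d, (∀ j < n, x j = y j) → (x ∈ A ↔ y ∈ A))
    {q : ENNReal} (hq : ∀ b : ℕ → Vec d, P.map (ξ s) {x | Function.update b s x ∈ A} ≤ q) :
    P {ω | (fun t => ξ t ω) ∈ A} ≤ q := by
  have h1 : IndepFun (ξ s)
      (fun ω => extendNoise s n (fun i : ((Finset.range n).erase s : Finset ℕ) => ξ i ω)) P := by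
    have h := hind.indepFun_finset₀ {s} ((Finset.range n).erase s) (by simp) hξ
    exact h.comp (φ := fun x : (({s} : Finset ℕ) → Vec d) => x ⟨s, by simp⟩)
      (measurable_pi_apply _) (measurable_extendNoise s n)
  have hmeas : Measurable fun p : Vec d × (ℕ → Vec d) => Function.update p.2 s p.1 := by
    refine measurable_pi_lambda _ fun j => ?_
    by_cases h : j = s
    · subst h; simpa using measurable_fst
    · simp only [Function.update_of_ne h]; fun_prop
  have h2 := measure_le_of_indepFun_of_section (hξ s)
    ((measurable_extendNoise s n).comp_aemeasurable (aemeasurable_pi_lambda _ fun i => hξ i))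
    h1 (hmeas hA) (q := q) (fun y => hq y)
  refine le_trans (le_of_eq ?_) h2
  congr 1
  ext ω
  refine hdep _ _ fun j hj => ?_
  by_cases h : j = s
  · subst h; simp
  · simp [extendNoise, h, hj]

lemma GradientLipschitz.continuous_gradient (hf : GradientLipschitz ℓ f) :
    Continuous (gradient f) :=
  (LipschitzWith.of_dist_le_mul (K := ℓ.toNNReal) fun x y => by
    rw [dist_eq_norm, dist_eq_norm]
    exact (hf.2 x y).trans (by gcongr; exact Real.le_coe_toNNReal ℓ)).continuous

lemma HessianLipschitz.continuous_hessian (hf : HessianLipschitz ρ f) :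
    Continuous (hessian f) :=
  (LipschitzWith.of_dist_le_mul (K := ρ.toNNReal) fun x y => by
    rw [dist_eq_norm, dist_eq_norm]
    exact (hf.2.2 x y).trans (by gcongr; exact Real.le_coe_toNNReal ρ)).continuous

lemma continuous_iterate (hf : GradientLipschitz ℓ f) (η : ℝ) (x₀ : Vec d) :
    ∀ t, Continuous fun ξ : ℕ → Vec d => iterate f η x₀ ξ t
  | 0 => continuous_const
  | t + 1 => by
    have h := continuous_iterate hf η x₀ t
    have h' := hf.continuous_gradient.comp h
    exact h.sub ((h'.add (continuous_apply t)).const_smul η)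

lemma isClosed_curvature (hf : HessianLipschitz ρ f) (γ : ℝ) :
    IsClosed {x | ∀ v : Vec d, -γ * ‖v‖ ^ 2 ≤ inner ℝ v (hessian f x v)} := by
  have h := hf.continuous_hessian
  rw [show {x | ∀ v : Vec d, -γ * ‖v‖ ^ 2 ≤ inner ℝ v (hessian f x v)} =
    ⋂ v : Vec d, {x | -γ * ‖v‖ ^ 2 ≤ inner ℝ v (hessian f x v)} by ext; simp]
  exact isClosed_iInter fun v => isClosed_le continuous_const
    (continuous_const.inner (h.clm_apply continuous_const))

lemma measurableSet_stuck (hf : GradientLipschitz ℓ f) (hf' : HessianLipschitz ρ f)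
    (η γ S : ℝ) (m : ℕ) (x₀ : Vec d) (s : ℕ) :
    MeasurableSet {ξ | Stuck f η γ S m x₀ s ξ} := by
  have hc := fun t => continuous_iterate hf η x₀ t
  have h1 : MeasurableSet {ξ : ℕ → Vec d | IsSaddle γ f (iterate f η x₀ ξ s)} :=
    (hc s).measurable (isClosed_curvature hf' γ).measurableSet.compl
  have h2 : MeasurableSet {ξ : ℕ → Vec d | ∀ j ≤ m,
      ‖iterate f η x₀ ξ (s + j) - iterate f η x₀ ξ s‖ ≤ S} := by
    simp only [Set.ofPred_forall]
    exact MeasurableSet.iInter fun j => MeasurableSet.iInter fun _ =>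
      (isClosed_le ((hc (s + j)).sub (hc s)).norm continuous_const).measurableSet
  exact h1.inter h2

lemma stuck_congr {η γ S : ℝ} {m : ℕ} {x₀ : Vec d} {s : ℕ} {ξ ξ' : ℕ → Vec d}
    (h : ∀ j < s + m, ξ j = ξ' j) :
    Stuck f η γ S m x₀ s ξ ↔ Stuck f η γ S m x₀ s ξ' := by
  unfold Stuck
  rw [iterate_congr (t := s) fun j hj => h j (by lia)]
  refine and_congr_right fun _ => forall₂_congr fun j hj => ?_
  rw [iterate_congr (t := s + j) fun i hi => h i (by lia)]

/-- The probability of being stuck at a saddle at time `s`. -/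
lemma measureReal_stuck_le (hf : GradientLipschitz ℓ f) (hf' : HessianLipschitz ρ f)
    (hd : 0 < d) (hℓ : 0 < ℓ) (hρ : 0 < ρ) {η γ S w r : ℝ} (hη : η = 1 / (2 * ℓ)) (hγ : 0 ≤ γ)
    (hS : 0 ≤ S) (hr : 0 < r) (hw0 : 0 ≤ w)
    {n : ℕ} (hβ : η * ρ * S * n ≤ 1 / 3) (hw : 4 * S ≤ w * (η * (1 + η * γ) ^ n))
    {Ω : Type*} [MeasurableSpace Ω] {P : Measure Ω} [IsProbabilityMeasure P]
    {ξ : ℕ → Ω → Vec d} (hlaw : ∀ t, HasLaw (ξ t) (noiseLaw d r) P) (hind : iIndepFun ξ P)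
    (x₀ : Vec d) (s : ℕ) :
    P.real {ω | Stuck f η γ S (n + 1) x₀ s fun t => ξ t ω} ≤ 2 * w * √d / r := by
  refine ENNReal.toReal_le_of_le_ofReal (by positivity) ?_
  have hA := measurableSet_stuck hf hf' η γ S (n + 1) x₀ s
  refine measure_le_of_iIndepFun_of_update (fun t => (hlaw t).aemeasurable) hind hA (s := s)
    (n := s + (n + 1)) (fun x y h => stuck_congr h) fun b => ?_
  rw [(hlaw s).map_eq]
  obtain ⟨e, he, hthin⟩ := abs_le_of_stuck hf hf' hℓ hρ hη hγ hS hβ hw x₀ s b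
  refine noiseLaw_le_of_thin hd hr (he hd.ne') ?_ hthin
  exact (measurable_update b) hA

/-! ### Descent along a trajectory -/

lemma iterate_descent (hf : GradientLipschitz ℓ f) (hℓ : 0 < ℓ) {η R : ℝ}
    (hη : η = 1 / (2 * ℓ)) {x₀ : Vec d} {ξ : ℕ → Vec d} {s j : ℕ}
    (hξ : ∀ i < s + j, ‖ξ i‖ ≤ R) :
    f (iterate f η x₀ ξ (s + j)) ≤ f (iterate f η x₀ ξ s)
      - η / 2 * ∑ i ∈ Finset.range j, ‖gradient f (iterate f η x₀ ξ (s + i))‖ ^ 2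
      + j * (η / 2 * R ^ 2) := by
  have hη0 : 0 < η := by subst hη; positivity
  induction j with
  | zero => simp
  | succ j ih =>
    have ih := ih fun i hi => hξ i (by lia)
    have h1 := hf.descent hℓ hη (iterate f η x₀ ξ (s + j)) (ξ (s + j))
    rw [← iterate_succ] at h1
    have h2 : η / 2 * ‖ξ (s + j)‖ ^ 2 ≤ η / 2 * R ^ 2 := by
      gcongr; exact hξ _ (by lia)
    rw [Finset.sum_range_succ, ← add_assoc]
    push_cast
    linarith

lemma norm_iterate_sub_le {η R : ℝ} (hη : 0 ≤ η) {x₀ : Vec d} {ξ : ℕ → Vec d} {s j : ℕ}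
    (hξ : ∀ i < s + j, ‖ξ i‖ ≤ R) :
    ‖iterate f η x₀ ξ (s + j) - iterate f η x₀ ξ s‖ ≤
      η * (∑ i ∈ Finset.range j, ‖gradient f (iterate f η x₀ ξ (s + i))‖ + j * R) := by
  induction j with
  | zero => simp
  | succ j ih =>
    have ih := ih fun i hi => hξ i (by lia)
    have h2 := hξ (s + j) (by lia)
    rw [Finset.sum_range_succ, ← add_assoc, iterate_succ, sub_right_comm]
    refine (norm_sub_le _ _).trans ?_
    rw [norm_smul, Real.norm_of_nonneg hη]
    have h3 : η * ‖gradient f (iterate f η x₀ ξ (s + j)) + ξ (s + j)‖ ≤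
        η * (‖gradient f (iterate f η x₀ ξ (s + j))‖ + R) := by
      gcongr; exact (norm_add_le _ _).trans (by linarith)
    push_cast
    linarith

/-- Leaving a ball within few steps forces a decrease of the function. -/
lemma iterate_decrease_of_moved (hf : GradientLipschitz ℓ f) (hℓ : 0 < ℓ) {η R S : ℝ}
    (hη : η = 1 / (2 * ℓ)) (hR : 0 ≤ R) {m : ℕ} (hS : 4 * R * (η * m) ≤ S)
    {x₀ : Vec d} {ξ : ℕ → Vec d} {s j : ℕ} (hjm : j ≤ m)
    (hξ : ∀ i < s + j, ‖ξ i‖ ≤ R)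
    (hmove : S < ‖iterate f η x₀ ξ (s + j) - iterate f η x₀ ξ s‖) :
    f (iterate f η x₀ ξ (s + j)) ≤ f (iterate f η x₀ ξ s) - j * (η * R ^ 2) := by
  have hη0 : 0 < η := by subst hη; positivity
  have h1 := iterate_descent hf hℓ hη (x₀ := x₀) hξ
  have h2 := hmove.trans_le (norm_iterate_sub_le hη0.le hξ)
  set a : ℕ → ℝ := fun i => ‖gradient f (iterate f η x₀ ξ (s + i))‖ with ha
  have hsq : (∑ i ∈ Finset.range j, a i) ^ 2 ≤ j * ∑ i ∈ Finset.range j, a i ^ 2 := by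
    simpa using sq_sum_le_card_mul_sum_sq (s := Finset.range j) (f := a)
  have hj0 : (0 : ℝ) < j := by
    rcases Nat.eq_zero_or_pos j with h | h
    · subst h
      have : 0 ≤ S := le_trans (by positivity) hS
      simp at hmove; linarith
    · exact_mod_cast h
  have h3 : 4 * R * (η * j) ≤ S := le_trans (by gcongr) hS
  -- The displacement exceeds `4jηR`, of which the noise explains at most `jηR`. By Cauchy–Schwarz
  -- the squared gradients then sum to at least `9jR²`, far more than the noise term `jR²`.
  have h4 : 3 * j * R ≤ ∑ i ∈ Finset.range j, a i := by
    have : η * (4 * j * R) ≤ η * (∑ i ∈ Finset.range j, a i + j * R) := by linarith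
    have := le_of_mul_le_mul_left this hη0
    linarith
  have h5 : 9 * j * R ^ 2 ≤ ∑ i ∈ Finset.range j, a i ^ 2 := by
    have h6 : (3 * j * R) ^ 2 ≤ (∑ i ∈ Finset.range j, a i) ^ 2 := by gcongr
    have h7 : j * (9 * j * R ^ 2) ≤ j * ∑ i ∈ Finset.range j, a i ^ 2 := by linarith
    exact le_of_mul_le_mul_left h7 hj0
  have h8 : η / 2 * (9 * j * R ^ 2) ≤ η / 2 * ∑ i ∈ Finset.range j, a i ^ 2 := by gcongr
  have h9 : 0 ≤ j * (η * R ^ 2) := by positivity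
  linarith

/-- If the noise is bounded, no iterate up to time `T` is second-order stationary, and no saddle
traps the iterates for `m` steps, then the function decreases at a linear rate. -/
lemma exists_iterate_decrease (hf : GradientLipschitz ℓ f) (hℓ : 0 < ℓ) {η R S ε : ℝ}
    (hη : η = 1 / (2 * ℓ)) (hR : 0 ≤ R) (hRε : 2 * R ≤ ε) {m T : ℕ}
    (hS : 4 * R * (η * m) ≤ S) {x₀ : Vec d} {ξ : ℕ → Vec d}
    (hξ : ∀ i < T + 1 + m, ‖ξ i‖ ≤ R)
    (hnot : ∀ t ≤ T, ¬ IsSOSP ρ ε f (iterate f η x₀ ξ t))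
    (hesc : ∀ s ≤ T, f (iterate f η x₀ ξ s) ≤ f x₀ → ¬ Stuck f η √(ρ * ε) S m x₀ s ξ) :
    ∃ t > T, f (iterate f η x₀ ξ t) ≤ f x₀ - t * (η * R ^ 2) := by
  have hη0 : 0 < η := by subst hη; positivity
  -- Progress comes in jumps of up to `m` steps, so the induction reaches some time `t ≥ k` rather
  -- than `k` itself; the last jump may overshoot, hence noise bounds up to `T + 1 + m`.
  suffices h : ∀ k ≤ T + 1, ∃ t ≥ k, f (iterate f η x₀ ξ t) ≤ f x₀ - t * (η * R ^ 2) from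
    h (T + 1) le_rfl
  intro k
  induction k with
  | zero => exact fun _ => ⟨0, le_rfl, by simp [iterate]⟩
  | succ k ih =>
    intro hk
    obtain ⟨t, htk, ht⟩ := ih (by lia)
    rcases htk.lt_or_eq with h | rfl
    · exact ⟨t, h, ht⟩
    have hadv : ∀ j ≥ 1, f (iterate f η x₀ ξ (k + j)) ≤
        f (iterate f η x₀ ξ k) - j * (η * R ^ 2) → ∃ t ≥ k + 1,
          f (iterate f η x₀ ξ t) ≤ f x₀ - t * (η * R ^ 2) := fun j hj h =>
      ⟨k + j, by lia, by push_cast; linarith⟩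
    by_cases hg : ‖gradient f (iterate f η x₀ ξ k)‖ ≤ ε
    · have hsad : IsSaddle √(ρ * ε) f (iterate f η x₀ ξ k) := fun h =>
        hnot k (by lia) ⟨hg, h⟩
      have hle : f (iterate f η x₀ ξ k) ≤ f x₀ := by
        have : 0 ≤ k * (η * R ^ 2) := by positivity
        linarith
      have hst := hesc k (by lia) hle
      obtain ⟨j, hj, hmove⟩ : ∃ j ≤ m,
          S < ‖iterate f η x₀ ξ (k + j) - iterate f η x₀ ξ k‖ := by
        by_contra! hcon
        exact hst ⟨hsad, hcon⟩
      refine hadv j ?_ (iterate_decrease_of_moved hf hℓ hη hR hS hj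
        (fun i hi => hξ i (by lia)) hmove)
      by_contra! hj0
      obtain rfl : j = 0 := by lia
      have : 0 ≤ S := le_trans (by positivity) hS
      simp at hmove; linarith
    · refine hadv 1 le_rfl ?_
      have h1 := iterate_descent hf hℓ hη (x₀ := x₀) (s := k) (j := 1)
        fun i hi => hξ i (by lia)
      simp only [Finset.range_one, Finset.sum_singleton, add_zero, Nat.cast_one, one_mul] at h1 ⊢
      have h2 : (2 * R) ^ 2 ≤ ‖gradient f (iterate f η x₀ ξ k)‖ ^ 2 := by
        gcongr; linarith
      nlinarith [sq_nonneg R]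

/-! ### Union bounds -/

lemma measureReal_exists_noise_gt_le {r a : ℝ} (hd : 0 < d) (hr : 0 < r) (ha : 0 ≤ a)
    {Ω : Type*} [MeasurableSpace Ω] {P : Measure Ω} [IsProbabilityMeasure P]
    {ξ : ℕ → Ω → Vec d} (hlaw : ∀ t, HasLaw (ξ t) (noiseLaw d r) P) (N : ℕ) :
    P.real {ω | ∃ i < N, r * a < ‖ξ i ω‖} ≤ N * (2 * d * Real.exp (-a ^ 2 / 2)) := by
  have hset : {ω | ∃ i < N, r * a < ‖ξ i ω‖} =
      ⋃ i ∈ Finset.range N, {ω | r * a < ‖ξ i ω‖} := by ext; simp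
  rw [hset]
  refine (measureReal_biUnion_finset_le _ _).trans ?_
  calc _ ≤ ∑ i ∈ Finset.range N, 2 * d * Real.exp (-a ^ 2 / 2) := by
        refine Finset.sum_le_sum fun i _ => ?_
        rw [(hlaw i).measureReal_eq (p := fun x => r * a < ‖x‖)
          (measurableSet_lt measurable_const measurable_norm)]
        exact noiseLaw_norm_gt_le hd hr ha
    _ = _ := by simp

/-- The probability guarantee, with the union bound over noise sizes and over saddles. -/
lemma one_sub_le_measureReal_exists_isSOSP (hd : 0 < d) (hf : GradientLipschitz ℓ f) (hℓ : 0 < ℓ)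
    (hbdd : BddBelow (Set.range f)) {η r a S ε q : ℝ}
    (hη : η = 1 / (2 * ℓ)) (hr : 0 < r) (ha : 0 ≤ a) (hRε : 2 * (r * a) ≤ ε) {m T : ℕ}
    (hS : 4 * (r * a) * (η * m) ≤ S) {x₀ : Vec d}
    (hT : f x₀ - (⨅ x, f x) < (T + 1) * (η * (r * a) ^ 2))
    {Ω : Type*} [MeasurableSpace Ω] (P : Measure Ω) [IsProbabilityMeasure P]
    {ξ : ℕ → Ω → Vec d} (hlaw : ∀ t, HasLaw (ξ t) (noiseLaw d r) P)
    (hstuck : ∀ s ≤ T, P.real {ω | f (iterate f η x₀ (fun t => ξ t ω) s) ≤ f x₀ ∧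
      Stuck f η √(ρ * ε) S m x₀ s fun t => ξ t ω} ≤ q) :
    1 - ((T + 1 + m : ℕ) * (2 * d * Real.exp (-a ^ 2 / 2)) + (T + 1) * q) ≤
      P.real {ω | ∃ t ≤ T, IsSOSP ρ ε f (iterate f η x₀ (fun s => ξ s ω) t)} := by
  have hη0 : 0 < η := by subst hη; positivity
  set G := {ω | ∃ t ≤ T, IsSOSP ρ ε f (iterate f η x₀ (fun s => ξ s ω) t)}
  set B := {ω | ∃ i < T + 1 + m, r * a < ‖ξ i ω‖}
  set C := ⋃ s ∈ Finset.range (T + 1), {ω | f (iterate f η x₀ (fun t => ξ t ω) s) ≤ f x₀ ∧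
      Stuck f η √(ρ * ε) S m x₀ s fun t => ξ t ω}
  -- Outside these events the function would fall below its infimum after time `T`.
  have hcover : Set.univ ⊆ G ∪ (B ∪ C) := by
    intro ω _
    by_contra hcon
    simp only [Set.mem_union, not_or] at hcon
    obtain ⟨hG, hB, hC⟩ := hcon
    have hG' : ∀ t ≤ T, ¬ IsSOSP ρ ε f (iterate f η x₀ (fun s => ξ s ω) t) := by
      intro t ht h; exact hG ⟨t, ht, h⟩
    have hB' : ∀ i < T + 1 + m, ‖ξ i ω‖ ≤ r * a := by
      intro i hi; by_contra! h; exact hB ⟨i, hi, h⟩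
    have hC' : ∀ s ≤ T, f (iterate f η x₀ (fun t => ξ t ω) s) ≤ f x₀ →
        ¬ Stuck f η √(ρ * ε) S m x₀ s fun t => ξ t ω := by
      intro s hs h h'
      exact hC (Set.mem_biUnion (Finset.mem_coe.2 (Finset.mem_range.2 (by lia))) ⟨h, h'⟩)
    obtain ⟨t, ht, hdec⟩ := exists_iterate_decrease hf hℓ hη (by positivity) hRε hS hB' hG' hC'
    have h1 := ciInf_le hbdd (iterate f η x₀ (fun s => ξ s ω) t)
    have h2 : ((T : ℝ) + 1) * (η * (r * a) ^ 2) ≤ t * (η * (r * a) ^ 2) := by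
      gcongr; exact_mod_cast ht
    linarith
  have h1 : (1 : ℝ) ≤ P.real G + (P.real B + P.real C) := by
    calc (1 : ℝ) = P.real Set.univ := by simp
      _ ≤ P.real (G ∪ (B ∪ C)) := measureReal_mono hcover
      _ ≤ P.real G + P.real (B ∪ C) := measureReal_union_le _ _
      _ ≤ _ := by gcongr; exact measureReal_union_le _ _
  have h2 : P.real B ≤ _ := measureReal_exists_noise_gt_le hd hr ha hlaw (T + 1 + m)
  have h3 : P.real C ≤ (T + 1) * q := by
    refine (measureReal_biUnion_finset_le _ _).trans ?_
    calc _ ≤ ∑ s ∈ Finset.range (T + 1), q :=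
          Finset.sum_le_sum fun s hs => hstuck s (by have := Finset.mem_range.1 hs; lia)
      _ = _ := by simp
  linarith

/-! ### Constraints imposed by the existence of a saddle -/

lemma IsSaddle.lt {γ : ℝ} (hf : GradientLipschitz ℓ f) (hℓ : 0 ≤ ℓ)
    {x : Vec d} (h : IsSaddle γ f x) : γ < ℓ := by
  obtain ⟨v, hv⟩ : ∃ v : Vec d, inner ℝ v (hessian f x v) < -γ * ‖v‖ ^ 2 := by
    simpa [IsSaddle] using h
  have h1 : -(ℓ * ‖v‖ ^ 2) ≤ inner ℝ v (hessian f x v) := by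
    refine neg_le_of_abs_le ((abs_real_inner_le_norm _ _).trans ?_)
    have := (hessian f x).le_of_opNorm_le (hf.norm_hessian_le hℓ x) v
    nlinarith [norm_nonneg v]
  by_contra! hle
  nlinarith [sq_nonneg ‖v‖]

lemma IsSaddle.cube_le {γ : ℝ} (hf : HessianLipschitz ρ f) (hρ : 0 < ρ)
    (hbdd : BddBelow (Set.range f)) (hγ : 0 ≤ γ) {x : Vec d} (h : IsSaddle γ f x) :
    γ ^ 3 / (64 * ρ ^ 2) ≤ f x - ⨅ y, f y := by
  obtain ⟨v, hv⟩ : ∃ v : Vec d, inner ℝ v (hessian f x v) < -γ * ‖v‖ ^ 2 := by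
    simpa [IsSaddle] using h
  obtain ⟨y, hy⟩ := hf.exists_le_of_neg_curvature hρ hγ hv
  linarith [ciInf_le hbdd y]

/-! ### Choice of parameters -/

namespace Params

variable (p : Params)

/-- The argument of the logarithm in `Params.logFactor`. -/
def size : ℝ := 2 + (p.d : ℝ) + p.ℓ + p.ρ + 1 / p.ε + 1 / p.δ + p.Δ

/-- The logarithmic scale `ι` of the analysis. -/
def scale : ℝ := 200 * p.logFactor

/-- The step size `η`. -/
def stepSize : ℝ := 1 / (2 * p.ℓ)

/-- The perturbation radius `r`. -/
def radius : ℝ := p.ε / (48 * p.scale ^ 3)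

/-- The number `T` of iterations. -/
def horizon : ℕ := ⌊p.Δ / (p.stepSize * (p.radius * p.scale) ^ 2)⌋₊

lemma one_le_d : (1 : ℝ) ≤ p.d := by exact_mod_cast p.d_pos

lemma inv_ε_pos : 0 < 1 / p.ε := one_div_pos.2 p.ε_pos

lemma inv_δ_pos : 0 < 1 / p.δ := one_div_pos.2 p.δ_pos

lemma three_le_size : 3 ≤ p.size := by
  unfold size
  linarith [p.one_le_d, p.ℓ_pos, p.ρ_pos, p.inv_ε_pos, p.inv_δ_pos, p.Δ_nonneg]

lemma ℓ_le_size : p.ℓ ≤ p.size := by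
  unfold size
  linarith [p.one_le_d, p.ℓ_pos, p.ρ_pos, p.inv_ε_pos, p.inv_δ_pos, p.Δ_nonneg]

lemma d_le_size : p.d ≤ p.size := by
  unfold size
  linarith [p.one_le_d, p.ℓ_pos, p.ρ_pos, p.inv_ε_pos, p.inv_δ_pos, p.Δ_nonneg]

lemma Δ_le_size : p.Δ ≤ p.size := by
  unfold size
  linarith [p.one_le_d, p.ℓ_pos, p.ρ_pos, p.inv_ε_pos, p.inv_δ_pos, p.Δ_nonneg]

lemma inv_ε_le_size : 1 / p.ε ≤ p.size := by
  unfold size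
  linarith [p.one_le_d, p.ℓ_pos, p.ρ_pos, p.inv_ε_pos, p.inv_δ_pos, p.Δ_nonneg]

lemma inv_δ_le_size : 1 / p.δ ≤ p.size := by
  unfold size
  linarith [p.one_le_d, p.ℓ_pos, p.ρ_pos, p.inv_ε_pos, p.inv_δ_pos, p.Δ_nonneg]

lemma size_pos : 0 < p.size := by linarith [p.three_le_size]

lemma exp_logFactor : Real.exp p.logFactor = p.size := Real.exp_log p.size_pos

lemma one_le_logFactor : 1 ≤ p.logFactor := by
  rw [← Real.exp_le_exp, exp_logFactor]
  linarith [Real.exp_one_lt_three, p.three_le_size]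

lemma le_scale : 200 ≤ p.scale := by unfold scale; linarith [p.one_le_logFactor]

lemma scale_pos : 0 < p.scale := by linarith [p.le_scale]

/-- The reason for the factor `200`: a growth of `exp (scale / 2)` beats every polynomial loss in
`size` that occurs below. -/
lemma exp_half_scale : Real.exp (p.scale / 2) = p.size ^ 100 := by
  rw [← exp_logFactor, ← Real.exp_nat_mul, scale]
  congr 1; push_cast; ring

lemma scale_le : p.scale ≤ p.size ^ 6 := by
  have h1 : p.logFactor ≤ p.size := by
    have := Real.add_one_le_exp p.logFactor
    rw [exp_logFactor] at this; linarith
  have h3 : (3 : ℝ) ^ 5 ≤ p.size ^ 5 := by gcongr; exact p.three_le_size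
  have := p.size_pos
  calc p.scale ≤ 200 * p.size := by unfold scale; gcongr
    _ ≤ p.size ^ 5 * p.size := by gcongr; linarith
    _ = _ := by ring

lemma stepSize_pos : 0 < p.stepSize := by have := p.ℓ_pos; unfold stepSize; positivity

lemma radius_pos : 0 < p.radius := by
  have := p.ε_pos; have := p.scale_pos; unfold radius; positivity

lemma radius_mul_scale : p.radius * p.scale = p.ε / (48 * p.scale ^ 2) := by
  have := p.scale_pos
  unfold radius; field_simp

lemma horizon_le : (p.horizon : ℝ) ≤ 4608 * p.scale ^ 4 * (p.ℓ * p.Δ / p.ε ^ 2) := by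
  have h1 := p.scale_pos
  have h2 := p.stepSize_pos
  have h3 := p.radius_pos
  have h4 := p.ε_pos
  have h5 := p.ℓ_pos
  refine (Nat.floor_le (div_nonneg p.Δ_nonneg (by positivity))).trans (le_of_eq ?_)
  rw [radius_mul_scale, stepSize]
  field_simp
  ring

lemma lt_horizon : p.Δ < (p.horizon + 1) * (p.stepSize * (p.radius * p.scale) ^ 2) := by
  have h1 := p.scale_pos
  have h2 := p.stepSize_pos
  have h3 := p.radius_pos
  rw [← div_lt_iff₀ (by positivity)]
  exact Nat.lt_floor_add_one _

lemma horizon_add_one_le : (p.horizon : ℝ) + 1 ≤ p.size ^ 37 := by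
  have hX := p.three_le_size
  have hX0 := p.size_pos
  have h1 := p.scale_pos
  have h8 : (3 : ℝ) ^ 8 ≤ p.size ^ 8 := by gcongr
  have e : p.ℓ * p.Δ / p.ε ^ 2 = p.ℓ * p.Δ * (1 / p.ε) ^ 2 := by
    have := p.ε_pos
    field_simp
  have h2 : p.ℓ * p.Δ / p.ε ^ 2 ≤ p.size * p.size * p.size ^ 2 := by
    rw [e]
    have := p.inv_ε_pos
    exact mul_le_mul (mul_le_mul p.ℓ_le_size p.Δ_le_size p.Δ_nonneg hX0.le)
      (by gcongr; exact p.inv_ε_le_size) (by positivity) (by positivity)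
  have h3 : (p.horizon : ℝ) ≤ p.size ^ 36 := by
    calc _ ≤ 4608 * p.scale ^ 4 * (p.ℓ * p.Δ / p.ε ^ 2) := p.horizon_le
      _ ≤ p.size ^ 8 * (p.size ^ 6) ^ 4 * (p.size * p.size * p.size ^ 2) := by
          have := p.scale_le
          have := div_nonneg (mul_nonneg p.ℓ_pos.le p.Δ_nonneg) (sq_nonneg p.ε)
          gcongr
          linarith
      _ = _ := by ring
  have h4 : (1 : ℝ) ≤ p.size ^ 36 := one_le_pow₀ (by linarith)
  calc (p.horizon : ℝ) + 1 ≤ 3 * p.size ^ 36 := by linarith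
    _ ≤ p.size * p.size ^ 36 := by gcongr
    _ = _ := by ring

/-- Of the two spare powers of `size`, one absorbs `1/δ` and the other the factor `3`. -/
lemma pow_mul_inv_le {k : ℕ} (hk : k ≤ 98) : p.size ^ k * (p.size ^ 100)⁻¹ ≤ p.δ / 3 := by
  have hX := p.three_le_size
  have hX0 := p.size_pos
  have h1 : 3 ≤ p.size ^ 2 * p.δ := by
    have h := p.inv_δ_le_size
    rw [div_le_iff₀ p.δ_pos] at h
    nlinarith
  calc p.size ^ k * (p.size ^ 100)⁻¹ ≤ p.size ^ 98 * (p.size ^ 100)⁻¹ := by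
        gcongr; linarith
    _ = (p.size ^ 2)⁻¹ := by field_simp
    _ ≤ _ := by
        rw [inv_le_iff_one_le_mul₀ (by positivity)]
        linarith

lemma exp_neg_scale_sq_le : Real.exp (-p.scale ^ 2 / 2) ≤ (p.size ^ 100)⁻¹ := by
  rw [← exp_half_scale, ← Real.exp_neg]
  refine Real.exp_le_exp.2 ?_
  nlinarith [p.le_scale]

lemma failure_le {m : ℕ} {q : ℝ} (hm : (m : ℝ) ≤ p.size ^ 16)
    (hq : q ≤ p.size ^ 26 * (p.size ^ 100)⁻¹) :
    (p.horizon + 1 + m : ℕ) * (2 * p.d * Real.exp (-p.scale ^ 2 / 2)) + (p.horizon + 1) * q ≤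
      p.δ := by
  have hX := p.three_le_size
  have hX0 := p.size_pos
  have h1 : ((p.horizon + 1 + m : ℕ) : ℝ) ≤ p.size ^ 38 := by
    have h2 := p.horizon_add_one_le
    have h3 : p.size ^ 16 ≤ p.size ^ 37 := pow_le_pow_right₀ (by linarith) (by norm_num)
    push_cast
    calc (p.horizon : ℝ) + 1 + m ≤ 3 * p.size ^ 37 := by
          have : 0 < p.size ^ 37 := by positivity
          linarith
      _ ≤ p.size * p.size ^ 37 := by gcongr
      _ = _ := by ring
  have h4 : ((p.horizon + 1 + m : ℕ) : ℝ) * (2 * p.d * Real.exp (-p.scale ^ 2 / 2)) ≤ p.δ / 3 := by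
    calc _ ≤ p.size ^ 38 * (p.size * p.size * (p.size ^ 100)⁻¹) := by
          have := p.exp_neg_scale_sq_le
          have := p.d_le_size
          gcongr
          linarith
      _ = p.size ^ 40 * (p.size ^ 100)⁻¹ := by ring
      _ ≤ _ := p.pow_mul_inv_le (by norm_num)
  have h5 : ((p.horizon : ℝ) + 1) * q ≤ p.δ / 3 := by
    calc _ ≤ ((p.horizon : ℝ) + 1) * (p.size ^ 26 * (p.size ^ 100)⁻¹) := by gcongr
      _ ≤ p.size ^ 37 * (p.size ^ 26 * (p.size ^ 100)⁻¹) := by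
          have := p.horizon_add_one_le
          gcongr
      _ = p.size ^ 63 * (p.size ^ 100)⁻¹ := by ring
      _ ≤ _ := p.pow_mul_inv_le (by norm_num)
  linarith [p.δ_pos]

lemma two_mul_radius_mul_scale_le : 2 * (p.radius * p.scale) ≤ p.ε := by
  have h := p.le_scale
  have hε := p.ε_pos
  rw [radius_mul_scale, ← mul_div_assoc, div_le_iff₀ (by positivity)]
  nlinarith [mul_pos hε p.scale_pos, mul_nonneg hε.le (sq_nonneg p.scale),
    mul_le_mul_of_nonneg_left h hε.le,
    mul_le_mul_of_nonneg_left h (mul_pos hε p.scale_pos).le]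

/-- The parameters of the escape phase, when saddles can occur. -/
lemma exists_escape_params (hγℓ : √(p.ρ * p.ε) ≤ p.ℓ)
    (hΔ : √(p.ρ * p.ε) ^ 3 / (64 * p.ρ ^ 2) ≤ p.Δ) :
    ∃ (S w : ℝ) (n : ℕ), 0 ≤ S ∧ 0 ≤ w ∧
      4 * (p.radius * p.scale) * (p.stepSize * ((n + 1 : ℕ) : ℝ)) ≤ S ∧
      p.stepSize * p.ρ * S * n ≤ 1 / 3 ∧
      4 * S ≤ w * (p.stepSize * (1 + p.stepSize * √(p.ρ * p.ε)) ^ n) ∧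
      ((n + 1 : ℕ) : ℝ) ≤ p.size ^ 16 ∧
      2 * w * √p.d / p.radius ≤ p.size ^ 26 * (p.size ^ 100)⁻¹ := by
  have hX := p.three_le_size
  have hX0 := p.size_pos
  have hι := p.scale_pos
  have hι' := p.le_scale
  have hη := p.stepSize_pos
  have hρ := p.ρ_pos
  have hε := p.ε_pos
  have hℓ := p.ℓ_pos
  have hr := p.radius_pos
  set γ := √(p.ρ * p.ε) with hγdef
  have hγ : 0 < γ := Real.sqrt_pos.2 (by positivity)
  have hγ2 : γ ^ 2 = p.ρ * p.ε := Real.sq_sqrt (by positivity)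
  have hηℓ : p.stepSize * p.ℓ = 1 / 2 := by unfold stepSize; field_simp
  -- As `ρ` may be arbitrarily small, the bound comes from `hΔ`: since `γ² = ρε`, `γ³/(64ρ²) =
  -- ε²/(64γ)`, so `1/γ ≤ 64Δ/ε²`.
  have hκ : p.ℓ / γ ≤ p.size ^ 8 := by
    have e1 : γ ^ 3 / (64 * p.ρ ^ 2) = p.ε ^ 2 / (64 * γ) := by
      rw [div_eq_div_iff (by positivity) (by positivity)]
      have : γ ^ 4 = (p.ρ * p.ε) ^ 2 := by rw [← hγ2]; ring
      linear_combination 64 * this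
    rw [e1, div_le_iff₀ (by positivity)] at hΔ
    have e2 : p.ℓ / γ ≤ 64 * (p.ℓ * p.Δ * (1 / p.ε) ^ 2) := by
      rw [div_le_iff₀ hγ]
      have : 1 ≤ p.Δ * (64 * γ) * (1 / p.ε) ^ 2 := by
        rw [one_div, inv_pow, ← div_eq_mul_inv, le_div_iff₀ (by positivity)]
        linarith
      nlinarith
    have := p.inv_ε_pos
    have h81 : (3 : ℝ) ^ 4 ≤ p.size ^ 4 := by gcongr
    calc p.ℓ / γ ≤ 64 * (p.ℓ * p.Δ * (1 / p.ε) ^ 2) := e2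
      _ ≤ p.size ^ 4 * (p.size * p.size * p.size ^ 2) := by
          refine mul_le_mul (by linarith) (mul_le_mul
            (mul_le_mul p.ℓ_le_size p.Δ_le_size p.Δ_nonneg hX0.le)
            (by gcongr; exact p.inv_ε_le_size) (by positivity) (by positivity)) ?_ (by positivity)
          exact mul_nonneg (mul_nonneg hℓ.le p.Δ_nonneg) (by positivity)
      _ = _ := by ring
  have hηγ : p.stepSize * γ ≤ 1 / 2 := by rw [← hηℓ]; gcongr
  have hηγ0 : 0 < p.stepSize * γ := by positivity
  -- Long enough for `(1 + ηγ)^n` to reach `exp (scale / 2) = size^100`.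
  set n := ⌈p.scale / (p.stepSize * γ)⌉₊ with hn
  have hn1 : p.scale / (p.stepSize * γ) ≤ n := Nat.le_ceil _
  have hn2 : ((n + 1 : ℕ) : ℝ) ≤ 2 * (p.scale / (p.stepSize * γ)) := by
    have h1 := (Nat.ceil_lt_add_one (a := p.scale / (p.stepSize * γ)) (by positivity)).le
    have h2 : 2 ≤ p.scale / (p.stepSize * γ) := by
      rw [le_div_iff₀ hηγ0]; linarith
    push_cast
    linarith
  have hηm : p.stepSize * ((n + 1 : ℕ) : ℝ) ≤ 2 * p.scale / γ := by
    calc _ ≤ p.stepSize * (2 * (p.scale / (p.stepSize * γ))) := by gcongr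
      _ = _ := by field_simp
  -- From `η(n + 1) ≤ 2ι/γ`, with `ι` the scale, this `S` gives exactly `1/3` in the linearization
  -- bound, and the `48` in `radius` makes `4R · 2ι/γ` equal to it. The width `w` is `4S` divided by
  -- `η` times the guaranteed growth.
  refine ⟨γ / (6 * p.scale * p.ρ), 4 * (γ / (6 * p.scale * p.ρ)) / (p.stepSize * p.size ^ 100), n,
    by positivity, by positivity, ?_, ?_, ?_, ?_, ?_⟩
  · calc _ ≤ 4 * (p.radius * p.scale) * (2 * p.scale / γ) := by gcongr
      _ = γ / (6 * p.scale * p.ρ) := by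
          rw [radius_mul_scale]
          field_simp
          rw [hγ2]
          ring
  · have h1 : p.stepSize * n ≤ 2 * p.scale / γ := by
      refine le_trans ?_ hηm
      gcongr
      simp
    calc _ = (p.ρ * (γ / (6 * p.scale * p.ρ))) * (p.stepSize * n) := by ring
      _ ≤ (p.ρ * (γ / (6 * p.scale * p.ρ))) * (2 * p.scale / γ) := by gcongr
      _ = 1 / 3 := by field_simp; norm_num
  · have h1 : p.size ^ 100 ≤ (1 + p.stepSize * γ) ^ n := by
      have h2 : Real.exp (p.stepSize * γ / 2) ≤ 1 + p.stepSize * γ := by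
        have h3 := Real.exp_bound_div_one_sub_of_interval (x := p.stepSize * γ / 2)
          (by positivity) (by linarith)
        refine h3.trans ?_
        rw [div_le_iff₀ (by linarith)]
        nlinarith
      calc p.size ^ 100 = Real.exp (p.scale / 2) := p.exp_half_scale.symm
        _ ≤ Real.exp (n * (p.stepSize * γ / 2)) := by
            refine Real.exp_le_exp.2 ?_
            rw [div_le_iff₀ hηγ0] at hn1
            linarith
        _ = Real.exp (p.stepSize * γ / 2) ^ n := Real.exp_nat_mul _ _
        _ ≤ _ := by gcongr
    calc 4 * (γ / (6 * p.scale * p.ρ)) = 4 * (γ / (6 * p.scale * p.ρ)) /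
          (p.stepSize * p.size ^ 100) * (p.stepSize * p.size ^ 100) := by field_simp
      _ ≤ _ := by gcongr
  · calc _ ≤ 2 * (p.scale / (p.stepSize * γ)) := hn2
      _ = 4 * p.scale * (p.ℓ / γ) := by unfold stepSize; field_simp; norm_num
      _ ≤ p.size ^ 2 * p.size ^ 6 * p.size ^ 8 := by
          have := p.scale_le
          gcongr
          nlinarith
      _ = _ := by ring
  · have hsd : √(p.d : ℝ) ≤ p.size := by
      refine le_trans ?_ p.d_le_size
      rw [Real.sqrt_le_left (by linarith [p.one_le_d])]
      nlinarith [p.one_le_d]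
    have h5 : (3 : ℝ) ^ 5 ≤ p.size ^ 5 := by gcongr
    calc _ = (128 * p.scale ^ 2 * (p.ℓ / γ) * √p.d) * (p.size ^ 100)⁻¹ := by
          unfold stepSize radius
          field_simp
          rw [hγ2]
          ring
      _ ≤ (p.size ^ 5 * (p.size ^ 6) ^ 2 * p.size ^ 8 * p.size) * (p.size ^ 100)⁻¹ := by
          have := p.scale_le
          gcongr
          linarith
      _ = _ := by ring

end Params

/-! ### Asymptotic orders of the parameters -/

lemma softTheta_stepSize : SoftTheta Params.stepSize fun p => 1 / p.ℓ := by
  refine ⟨⟨1, 0, fun p => ?_⟩, ⟨2, 0, fun p => ?_⟩⟩ <;> have h := p.ℓ_pos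
  · rw [abs_of_pos p.stepSize_pos, abs_of_pos (by positivity), Params.stepSize, pow_zero, one_mul,
      one_mul]
    exact one_div_le_one_div_of_le h (by linarith)
  · rw [abs_of_pos p.stepSize_pos, abs_of_pos (by positivity), Params.stepSize]
    refine le_of_eq ?_
    field_simp

lemma softTheta_radius : SoftTheta Params.radius fun p => p.ε := by
  refine ⟨⟨1, 0, fun p => ?_⟩, ⟨48 * 200 ^ 3, 3, fun p => ?_⟩⟩ <;> have h := p.ε_pos
  · rw [abs_of_pos p.radius_pos, abs_of_pos h, Params.radius, pow_zero, one_mul, one_mul]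
    have : 1 ≤ p.scale ^ 3 := one_le_pow₀ (by linarith [p.le_scale])
    exact div_le_self h.le (by linarith)
  · have hι := p.scale_pos
    have hΛ : 0 < p.logFactor := by linarith [p.one_le_logFactor]
    rw [abs_of_pos p.radius_pos, abs_of_pos h, Params.radius, Params.scale]
    refine le_of_eq ?_
    field_simp

lemma softO_horizon : SoftO (fun p => (p.horizon : ℝ)) fun p => p.ℓ * p.Δ / p.ε ^ 2 := by
  refine ⟨4608 * 200 ^ 4, 4, fun p => ?_⟩
  have h := p.ε_pos
  have h1 : 0 ≤ p.ℓ * p.Δ / p.ε ^ 2 := div_nonneg (mul_nonneg p.ℓ_pos.le p.Δ_nonneg) (by positivity)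
  rw [abs_of_nonneg h1, Nat.abs_cast]
  refine p.horizon_le.trans (le_of_eq ?_)
  rw [Params.scale]
  ring

end PGD

end

/-! ### Assembly -/

theorem theorem2 :
    ∃ (η r : PGD.Params → ℝ) (T : PGD.Params → ℕ),
      (∀ p, 0 < η p) ∧ (∀ p, 0 < r p) ∧
      PGD.SoftTheta η (fun p => 1 / p.ℓ) ∧
      PGD.SoftTheta r (fun p => p.ε) ∧
      PGD.SoftO (fun p => (T p : ℝ)) (fun p => p.ℓ * p.Δ / p.ε ^ 2) ∧
      ∀ (p : PGD.Params) (f : PGD.Vec p.d → ℝ) (x₀ : PGD.Vec p.d),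
        PGD.GradientLipschitz p.ℓ f →
        PGD.HessianLipschitz p.ρ f →
        BddBelow (Set.range f) →
        f x₀ - (⨅ x, f x) = p.Δ →
        ∀ {Ω : Type*} [MeasurableSpace Ω] (P : Measure Ω) [IsProbabilityMeasure P]
          (ξ : ℕ → Ω → PGD.Vec p.d),
          (∀ t, HasLaw (ξ t) (PGD.noiseLaw p.d (r p)) P) →
          iIndepFun ξ P →
          1 - p.δ ≤ P.real {ω | ∃ t ≤ T p,
            PGD.IsSOSP p.ρ p.ε f (PGD.iterate f (η p) x₀ (fun s => ξ s ω) t)} := by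
  refine ⟨PGD.Params.stepSize, PGD.Params.radius, PGD.Params.horizon,
    PGD.Params.stepSize_pos, PGD.Params.radius_pos, PGD.softTheta_stepSize, PGD.softTheta_radius,
    PGD.softO_horizon, ?_⟩
  intro p f x₀ hf hf' hbdd hΔ Ω _ P _ ξ hlaw hind
  suffices h : ∃ (S q : ℝ) (m : ℕ),
      4 * (p.radius * p.scale) * (p.stepSize * (m : ℝ)) ≤ S ∧ (m : ℝ) ≤ p.size ^ 16 ∧
      q ≤ p.size ^ 26 * (p.size ^ 100)⁻¹ ∧
      ∀ s ≤ p.horizon, P.real {ω | f (PGD.iterate f p.stepSize x₀ (fun t => ξ t ω) s) ≤ f x₀ ∧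
        PGD.Stuck f p.stepSize √(p.ρ * p.ε) S m x₀ s fun t => ξ t ω} ≤ q by
    obtain ⟨S, q, m, hS, hm, hq, hstuck⟩ := h
    have key := PGD.one_sub_le_measureReal_exists_isSOSP (ρ := p.ρ) p.d_pos hf p.ℓ_pos hbdd
      (η := p.stepSize) rfl p.radius_pos p.scale_pos.le p.two_mul_radius_mul_scale_le hS
      (T := p.horizon) (x₀ := x₀) (by rw [hΔ]; exact p.lt_horizon) P hlaw hstuck
    linarith [p.failure_le hm hq]
  have hγ : 0 ≤ √(p.ρ * p.ε) := Real.sqrt_nonneg _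
  have hX := p.size_pos
  by_cases hcase : √(p.ρ * p.ε) ≤ p.ℓ ∧ √(p.ρ * p.ε) ^ 3 / (64 * p.ρ ^ 2) ≤ p.Δ
  · obtain ⟨S, w, n, hS, hw, hSm, hβ, hgrow, hm, hq⟩ := p.exists_escape_params hcase.1 hcase.2
    refine ⟨S, 2 * w * √p.d / p.radius, n + 1, hSm, hm, hq, fun s _ => ?_⟩
    refine le_trans (measureReal_mono fun ω hω => hω.2)
      (PGD.measureReal_stuck_le hf hf' p.d_pos p.ℓ_pos p.ρ_pos rfl hγ hS p.radius_pos hw hβ hgrow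
        hlaw hind x₀ s)
  -- No saddle can occur at a level at most `f x₀`. With `m = 0` and `S = 0`, being stuck just means
  -- being at a saddle, so the event is empty.
  · refine ⟨0, 0, 0, by simp, by simp; positivity, by positivity, fun s _ => ?_⟩
    rw [show {ω | f (PGD.iterate f p.stepSize x₀ (fun t => ξ t ω) s) ≤ f x₀ ∧
        PGD.Stuck f p.stepSize √(p.ρ * p.ε) 0 0 x₀ s fun t => ξ t ω} = ∅ from ?_]
    · simp
    · refine Set.eq_empty_of_forall_notMem fun ω hω => hcase ⟨?_, ?_⟩
      · exact (hω.2.1.lt hf p.ℓ_pos.le).le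
      · have h1 := hω.2.1.cube_le hf' p.ρ_pos hbdd hγ
        have h2 := hω.1
        linarith
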